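/- **Setting.** Let $p\in[1,2]$, $1/p+1/q=1$, and let $Q\subset\mathbb R^n$ be a bounded convex set with $\bar R=\sup_{x,y\in Q}\|x-y\|_p$. Let $\xi$ be a random element, let $f(x)=\mathbb E_\xi f(x,\xi)$ be (finite and) convex on $Q$, let $x_*\in Q$ be a minimizer of $f$ on $Q$, and $f_*=f(x_*)$. Let $\nabla_x f(x,\xi)$ be a (jointly measurable) stochastic subgradient: for every $x\in Q$ the vector $\mathbb E_\xi\nabla_x f(x,\xi)$ exists and is a subgradient of $f$ on $Q$ at $x$. Let $d\ge 0$ be a prox-function on $Q$, i.e. $1$-strongly convex on $Q$ with respect to $\|\cdot\|_p$, with $x^0\in Q$, $d(x^0)=0$, $d$ differentiable at $x^0$ relative to $Q$; put $V(x,y)=d(x)-d(y)-\langle\nabla d(y),x-y\rangle$ and $R=\sqrt{V(x_*,x^0)}$. A mirror-descent trajectory with $N\ge1$ steps is $$x^{k+1}=\arg\min_{x\in Q}\bigl\{\langle h\nabla_x f(x^k,\xi^k),x-x^k\rangle+V(x,x^k)\bigr\},\quad k=0,\dots,N-1,\qquad h=\frac RM\sqrt{\frac2N},$$ with $\xi^0,\dots,\xi^{N-1}$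 independent copies of $\xi$ and with $d$ differentiable relative to $Q$ at the points $x^0,\dots,x^{N-1}$; its output is $\frac1N\sum_{k=0}^{N-1}x^k$. **Theorem.** Let $M>0$, $\varepsilon>0$, $\sigma\in(0,1)$, and suppose that one of the following holds for all $x\in Q$: i) $\|\nabla_x f(x,\xi)\|_q\le M$ almost surely; ii) $\mathbb E_\xi\exp\bigl(\|\nabla_x f(x,\xi)\|_q^2/M^2\bigr)\le\exp(1)$, and $N\ge c\ln\sigma^{-1}$; iii) for some $\alpha>2$, $\mathbb P\bigl(\|\nabla_x f(x,\xi)\|_q^2/M^2\ge t\bigr)\le(1+t)^{-\alpha}$ for all $t\ge0$, and $N\ge c\,\sigma^{-1/(\alpha-1)}$. There are constants $C>0$ and $c>0$, where in cases i), ii) both are absolute and $C\le 50\cdot 3$, and in case iii) both depend only on $\alpha$, such that the following is true. Let $K=\lceil 2\log_2\sigma^{-1}\rceil$ and let $\bar x^{N,1},\dots,\bar x^{N,K}$ be the outputs of $K$ mirror-descent trajectories, each with the same number of steps $$N\ \ge\ \frac{C M^2\max\{R,\bar R\}^2}{\varepsilon^2},$$ driven by independent samples (all $KN$ copies of $\xi$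 are independent). Then $\bar x^N=\frac1K\sum_{i=1}^K\bar x^{N,i}$ satisfies $$\mathbb P\bigl(f(\bar x^N)-f_*\le\varepsilon\bigr)\ \ge\ 1-\sigma .$$ In particular, if $R\le\bar R$, then $N=\lceil CM^2\bar R^2/\varepsilon^2\rceil$ steps (if this number is positive and meets the lower bound on $N$ in ii) or iii)) suffice. -/

import Mathlib

open MeasureTheory ProbabilityTheory
open scoped ENNReal

universe u v

noncomputable section

namespace MirrorDescent

/-- `ℝⁿ` with the `p`-norm. -/
abbrev Vec (p : ℝ≥0∞) (n : ℕ) : Type := PiLp p (fun _ : Fin n => ℝ)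

/-- The standard pairing `⟨g, x⟩ = ∑ gᵢ xᵢ`; the gradient side is measured in the `q`-norm,
the point side in the `p`-norm. -/
def pairing {p q : ℝ≥0∞} {n : ℕ} (g : Vec q n) (x : Vec p n) : ℝ := ∑ i, g i * x i

/-- `d` is a prox-function on `Q` with centre `x₀`: nonnegative on `Q`, zero at `x₀`, and
`1`-strongly convex on `Q` for the `p`-norm. Differentiability is relative to `Q` and is
demanded only at the centre, so that the entropy on the simplex is included. -/
structure IsProxFunction {p : ℝ≥0∞} [Fact (1 ≤ p)] {n : ℕ}
    (Q : Set (Vec p n)) (d : Vec p n → ℝ) (x₀ : Vec p n) : Prop where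
  mem : x₀ ∈ Q
  nonneg : ∀ x ∈ Q, 0 ≤ d x
  zero : d x₀ = 0
  strongConvex : StrongConvexOn Q 1 d
  diff : DifferentiableWithinAt ℝ d Q x₀

/-- The Bregman divergence `V(x, y) = d(x) - d(y) - ⟨∇d(y), x - y⟩`. It is used for `x, y` in the
convex set `Q`, with `d` differentiable at `y` relative to `Q`; all derivatives of `d` at `y`
relative to `Q` then agree on `x - y`. -/
def bregman {p : ℝ≥0∞} [Fact (1 ≤ p)] {n : ℕ}
    (Q : Set (Vec p n)) (d : Vec p n → ℝ) (x y : Vec p n) : ℝ :=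
  d x - d y - fderivWithin ℝ d Q y (x - y)

/-- `z = Mirr_y(v) = argmin_{x ∈ Q} {⟨v, x - y⟩ + V(x, y)}`. The minimizer is unique when `d` is
strongly convex on `Q`. -/
def IsMirr {p q : ℝ≥0∞} [Fact (1 ≤ p)] {n : ℕ}
    (Q : Set (Vec p n)) (d : Vec p n → ℝ) (y : Vec p n) (v : Vec q n) (z : Vec p n) : Prop :=
  z ∈ Q ∧ IsMinOn (fun x => pairing v (x - y) + bregman Q d x y) Q z

/-- `x` is the mirror-descent trajectory with `N` steps of size `h` from `x₀`, driven by the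
stochastic subgradients `G (x k) (ξ k)`: `x (k+1) = Mirr_{x k}(h G(x k, ξ k))`. The points at which
the Bregman divergence is centred must be points of differentiability of `d`, and `x k` is a
measurable function of `ξ 0, …, ξ (k-1)`. -/
structure IsTrajectory {p q : ℝ≥0∞} [Fact (1 ≤ p)] {n : ℕ}
    {Ω Ξ : Type*} [MeasurableSpace Ξ]
    (Q : Set (Vec p n)) (d : Vec p n → ℝ) (x₀ : Vec p n) (G : Vec p n → Ξ → Vec q n)
    (h : ℝ) (N : ℕ) (ξ : Fin N → Ω → Ξ) (x : ℕ → Ω → Vec p n) : Prop where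
  start : ∀ ω, x 0 ω = x₀
  diff : ∀ k < N, ∀ ω, DifferentiableWithinAt ℝ d Q (x k ω)
  step : ∀ (k : Fin N) (ω : Ω), IsMirr Q d (x k ω) (h • G (x k ω) (ξ k ω)) (x (k + 1) ω)
  adapted : ∀ k ≤ N, Measurable[⨆ j : Fin N, ⨆ _ : (j : ℕ) < k,
    MeasurableSpace.comap (ξ j) inferInstance] (x k)

/-- The average `(1/N) ∑_{k<N} x k` of a trajectory. -/
def trajectoryMean {p : ℝ≥0∞} {n : ℕ} {Ω : Type*} (N : ℕ) (x : ℕ → Ω → Vec p n) (ω : Ω) : Vec p n :=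
  (N : ℝ)⁻¹ • ∑ k ∈ Finset.range N, x k ω

/-- `K = ⌈2 log₂ σ⁻¹⌉`. -/
def numTrajectories (σ : ℝ) : ℕ := ⌈2 * Real.logb 2 σ⁻¹⌉₊

/-- The expected objective `f(x) = E_ξ f(x, ξ)`. -/
def objective {p : ℝ≥0∞} {n : ℕ} {Ξ : Type*} [MeasurableSpace Ξ]
    (F : Vec p n → Ξ → ℝ) (ν : Measure Ξ) (x : Vec p n) : ℝ := ∫ s, F x s ∂ν

/-- `E_ξ G(x, ξ)` exists and is a subgradient at `x`, relative to `Q`, of `f`, for every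
`x ∈ Q`. -/
def IsUnbiasedSubgradient {p q : ℝ≥0∞} [Fact (1 ≤ q)] {n : ℕ} {Ξ : Type*} [MeasurableSpace Ξ]
    (Q : Set (Vec p n)) (f : Vec p n → ℝ) (G : Vec p n → Ξ → Vec q n) (ν : Measure Ξ) : Prop :=
  ∀ x ∈ Q, Integrable (G x) ν ∧ ∀ y ∈ Q, f x + pairing (∫ s, G x s ∂ν) (y - x) ≤ f y

/-- The three alternative conditions on the tails of the stochastic subgradient. -/
inductive TailRegime : Type
  | bounded : TailRegime
  | subGaussian : TailRegime
  | heavy (α : ℝ) : TailRegime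

namespace TailRegime

/-- The exponent of the heavy-tail regime exceeds `2`. -/
def Admissible : TailRegime → Prop
  | bounded => True
  | subGaussian => True
  | heavy α => 2 < α

/-- The tail condition on `‖G(x, ξ)‖_q`, uniformly over `x ∈ Q`. -/
def Holds {p q : ℝ≥0∞} [Fact (1 ≤ q)] {n : ℕ} {Ξ : Type*} [MeasurableSpace Ξ]
    (Q : Set (Vec p n)) (G : Vec p n → Ξ → Vec q n) (ν : Measure Ξ) (M : ℝ) : TailRegime → Prop
  | bounded => ∀ x ∈ Q, ∀ᵐ s ∂ν, ‖G x s‖ ≤ M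
  | subGaussian => ∀ x ∈ Q,
      ∫⁻ s, ENNReal.ofReal (Real.exp (‖G x s‖ ^ 2 / M ^ 2)) ∂ν ≤ ENNReal.ofReal (Real.exp 1)
  | heavy α => ∀ x ∈ Q, ∀ t : ℝ, 0 ≤ t →
      ν.real {s | t ≤ ‖G x s‖ ^ 2 / M ^ 2} ≤ (1 + t) ^ (-α)

/-- The number of steps is large compared with the quantity attached to the confidence level `σ`
in each regime, with constant `c`. -/
def LongEnough (c σ : ℝ) (N : ℕ) : TailRegime → Prop
  | bounded => True
  | subGaussian => c * Real.log σ⁻¹ ≤ N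
  | heavy α => c * σ ^ (-1 / (α - 1)) ≤ N

/-- The range allowed for the constant `C`: `C ≤ 50 · 3` is absolute in the first two regimes; in
the heavy-tail regime it is a finite number depending on `α`. -/
def ConstantRange (C : ℝ) : TailRegime → Prop
  | bounded => C ≤ 50 * 3
  | subGaussian => C ≤ 50 * 3
  | heavy _ => True

end TailRegime

end MirrorDescent

end

namespace MirrorDescent

section Pairing

variable {p q : ℝ≥0∞} {n : ℕ}

theorem pairing_comm (g : Vec q n) (x : Vec p n) : pairing g x = pairing x g := by
  simp [pairing, mul_comm]

/-- The pairing with a fixed vector as a continuous linear functional. -/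
noncomputable def pairingCLM [Fact (1 ≤ p)] (g : Vec q n) : Vec p n →L[ℝ] ℝ :=
  ∑ i, g i • PiLp.proj p (fun _ : Fin n => ℝ) i

theorem pairingCLM_apply [Fact (1 ≤ p)] (g : Vec q n) (x : Vec p n) :
    pairingCLM g x = pairing g x := by
  simp [pairingCLM, pairing]

theorem pairing_sub_right (g : Vec q n) (x y : Vec p n) :
    pairing g (x - y) = pairing g x - pairing g y := by
  simp [pairing, mul_sub]

theorem pairing_smul_left (c : ℝ) (g : Vec q n) (x : Vec p n) :
    pairing (c • g) x = c * pairing g x := by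
  simp [pairing, Finset.mul_sum, mul_assoc]

theorem pairing_neg_right (g : Vec q n) (x : Vec p n) : pairing g (-x) = -pairing g x := by
  simp [pairing]

/-- Hölder's inequality for the pairing of the `1`-norm with the `∞`-norm. -/
theorem pairing_le_one_top (g : Vec ∞ n) (x : Vec 1 n) : pairing g x ≤ ‖g‖ * ‖x‖ := by
  rw [PiLp.norm_eq_sum (p := 1) (by simp) x]
  simp only [ENNReal.toReal_one, Real.rpow_one, div_one, Finset.mul_sum, pairing]
  refine Finset.sum_le_sum fun i _ => ?_
  calc g i * x i ≤ ‖g i * x i‖ := Real.le_norm_self _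
    _ = ‖g i‖ * ‖x i‖ := norm_mul _ _
    _ ≤ ‖g‖ * ‖x i‖ := by gcongr; exact PiLp.norm_apply_le g i

/-- Hölder's inequality. -/
theorem pairing_le_norm_mul_norm [ENNReal.HolderConjugate p q]
    (g : Vec q n) (x : Vec p n) : pairing g x ≤ ‖g‖ * ‖x‖ := by
  by_cases hp : p = ∞
  · subst hp
    have hq : q = 1 := (ENNReal.HolderConjugate.eq_top_iff_eq_one ∞ q).1 rfl
    subst hq
    rw [pairing_comm, mul_comm]
    exact pairing_le_one_top x g
  by_cases hq : q = ∞
  · subst hq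
    have hp1 : p = 1 := (ENNReal.HolderConjugate.eq_top_iff_eq_one ∞ p).1 rfl
    subst hp1
    exact pairing_le_one_top g x
  have h := ENNReal.HolderConjugate.toReal_of_ne_top hp hq
  rw [PiLp.norm_eq_sum h.symm.pos g, PiLp.norm_eq_sum h.pos x]
  simpa [pairing] using Real.inner_le_Lp_mul_Lq Finset.univ g.ofLp x.ofLp h.symm

theorem abs_pairing_le [ENNReal.HolderConjugate p q] [Fact (1 ≤ p)]
    (g : Vec q n) (x : Vec p n) : |pairing g x| ≤ ‖g‖ * ‖x‖ := by
  refine abs_le.2 ⟨?_, pairing_le_norm_mul_norm g x⟩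
  have := pairing_le_norm_mul_norm g (-x)
  rw [pairing_neg_right, norm_neg] at this
  linarith

theorem neg_half_sq_le_pairing_add [ENNReal.HolderConjugate p q] [Fact (1 ≤ p)]
    (g : Vec q n) (x : Vec p n) : -(‖g‖ ^ 2 / 2) ≤ pairing g x + ‖x‖ ^ 2 / 2 := by
  have := (abs_le.1 (abs_pairing_le g x)).1
  nlinarith [sq_nonneg (‖g‖ - ‖x‖)]

theorem integral_pairing {Ξ : Type*} [MeasurableSpace Ξ] {ν : Measure Ξ} [Fact (1 ≤ q)]
    {g : Ξ → Vec q n} (hg : Integrable g ν) (x : Vec p n) :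
    ∫ s, pairing (g s) x ∂ν = pairing (∫ s, g s ∂ν) x := by
  have := (pairingCLM (p := q) x).integral_comp_comm hg
  simpa [pairingCLM_apply, pairing_comm x] using this

theorem integrable_pairing {Ξ : Type*} [MeasurableSpace Ξ] {ν : Measure Ξ} [Fact (1 ≤ q)]
    {g : Ξ → Vec q n} (hg : Integrable g ν) (x : Vec p n) :
    Integrable (fun s => pairing (g s) x) ν := by
  have := (pairingCLM (p := q) x).integrable_comp hg
  simpa [pairingCLM_apply, pairing_comm x] using this

theorem measurable_pairing {Ω : Type*} [MeasurableSpace Ω] {g : Ω → Vec q n} {x : Ω → Vec p n}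
    (hg : Measurable g) (hx : Measurable x) : Measurable fun ω => pairing (g ω) (x ω) := by
  unfold pairing
  refine Finset.measurable_sum _ fun i _ => Measurable.mul ?_ ?_
  · exact (measurable_pi_apply i).comp ((WithLp.measurable_ofLp q _).comp hg)
  · exact (measurable_pi_apply i).comp ((WithLp.measurable_ofLp p _).comp hx)

end Pairing

section Bregman

variable {p q : ℝ≥0∞} {n : ℕ} [Fact (1 ≤ p)]
  {Q : Set (Vec p n)} {d : Vec p n → ℝ}

theorem bregman_self (y : Vec p n) : bregman Q d y y = 0 := by simp [bregman]

/-- Strong convexity bounds the Bregman divergence from below. -/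
theorem half_sq_le_bregman (hd : StrongConvexOn Q 1 d) {y z : Vec p n} (hy : y ∈ Q) (hz : z ∈ Q)
    (hdy : DifferentiableWithinAt ℝ d Q y) : ‖z - y‖ ^ 2 / 2 ≤ bregman Q d z y := by
  have hγ : HasDerivWithinAt (fun t : ℝ => y + t • (z - y)) (z - y) (Set.Icc 0 1) 0 := by
    simpa using (((hasDerivAt_id (0 : ℝ)).smul_const (z - y)).const_add y).hasDerivWithinAt
  have hmaps : Set.MapsTo (fun t : ℝ => y + t • (z - y)) (Set.Icc 0 1) Q := fun t ht =>
    hd.1.add_smul_sub_mem hy hz ht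
  have hder : HasDerivWithinAt (fun t : ℝ => d (y + t • (z - y)))
      (fderivWithin ℝ d Q y (z - y)) (Set.Icc 0 1) 0 := by
    have h0 : HasFDerivWithinAt d (fderivWithin ℝ d Q y) Q (y + (0 : ℝ) • (z - y)) := by
      simpa using hdy.hasFDerivWithinAt
    exact h0.comp_hasDerivWithinAt (0 : ℝ) hγ hmaps
  have hder2 : HasDerivWithinAt
      (fun t : ℝ => t * (d z - d y) - (t * (1 - t)) * (‖z - y‖ ^ 2 / 2)
        - (d (y + t • (z - y)) - d y))
      ((d z - d y) - ‖z - y‖ ^ 2 / 2 - fderivWithin ℝ d Q y (z - y)) (Set.Icc 0 1) 0 := by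
    have h1 : HasDerivAt (fun t : ℝ => t * (d z - d y) - (t * (1 - t)) * (‖z - y‖ ^ 2 / 2))
        ((d z - d y) - ‖z - y‖ ^ 2 / 2) 0 := by
      have := ((hasDerivAt_id (0 : ℝ)).mul_const (d z - d y)).sub
        (((hasDerivAt_id (0 : ℝ)).mul ((hasDerivAt_id (0 : ℝ)).const_sub 1)).mul_const
          (‖z - y‖ ^ 2 / 2))
      exact this.congr_deriv (by simp)
    exact h1.hasDerivWithinAt.sub (hder.sub_const _)
  have hmin : IsMinOn (fun t : ℝ => t * (d z - d y) - (t * (1 - t)) * (‖z - y‖ ^ 2 / 2)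
        - (d (y + t • (z - y)) - d y)) (Set.Icc 0 1) 0 := by
    intro t ht
    have := hd.2 hz hy ht.1 (sub_nonneg.2 ht.2) (by ring)
    have he : t • z + (1 - t) • y = y + t • (z - y) := by module
    rw [he] at this
    simp only [smul_eq_mul] at this
    simp only [Set.mem_ofPred_eq, zero_mul, zero_smul, add_zero, sub_self]
    linarith
  have h1 : (1 : ℝ) ∈ posTangentConeAt (Set.Icc (0 : ℝ) 1) 0 :=
    mem_posTangentConeAt_of_segment_subset (by simp [segment_eq_Icc])
  have := hmin.localize.hasFDerivWithinAt_nonneg hder2.hasFDerivWithinAt h1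
  simp only [ContinuousLinearMap.toSpanSingleton_apply, one_smul] at this
  unfold bregman
  linarith

/-- One mirror step, without differentiability at the new point. -/
theorem IsMirr.pairing_le [ENNReal.HolderConjugate p q] (hd : StrongConvexOn Q 1 d)
    {x y z : Vec p n} {v : Vec q n} (hx : x ∈ Q) (hy : y ∈ Q)
    (hdy : DifferentiableWithinAt ℝ d Q y) (h : IsMirr Q d y v z) :
    pairing v (y - x) ≤ bregman Q d x y + ‖v‖ ^ 2 / 2 := by
  have h1 : pairing v (z - y) + bregman Q d z y ≤ pairing v (x - y) + bregman Q d x y := h.2 hx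
  have h2 := half_sq_le_bregman hd hy h.1 hdy
  have h3 := neg_half_sq_le_pairing_add v (z - y)
  simp only [pairing_sub_right] at *
  linarith

/-- One mirror step: the Bregman divergence to any point of `Q` telescopes. -/
theorem IsMirr.pairing_add_bregman_le [ENNReal.HolderConjugate p q] (hd : StrongConvexOn Q 1 d)
    {x y z : Vec p n} {v : Vec q n} (hx : x ∈ Q) (hy : y ∈ Q)
    (hdy : DifferentiableWithinAt ℝ d Q y) (hdz : DifferentiableWithinAt ℝ d Q z)
    (h : IsMirr Q d y v z) :
    pairing v (y - x) + bregman Q d x z ≤ bregman Q d x y + ‖v‖ ^ 2 / 2 := by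
  have h2 := half_sq_le_bregman hd hy h.1 hdy
  have h3 := neg_half_sq_le_pairing_add v (z - y)
  have hder : HasFDerivWithinAt (fun x => pairing v (x - y) + bregman Q d x y)
      (pairingCLM v + (fderivWithin ℝ d Q z - fderivWithin ℝ d Q y)) Q z := by
    have e1 : HasFDerivWithinAt (fun x : Vec p n => pairing v (x - y)) (pairingCLM v) Q z := by
      have := ((pairingCLM v : Vec p n →L[ℝ] ℝ).hasFDerivWithinAt (s := Q) (x := z)).sub_const
        (pairing v y)
      simpa only [pairingCLM_apply, ← pairing_sub_right] using this
    have e2 : HasFDerivWithinAt (fun x => fderivWithin ℝ d Q y (x - y)) (fderivWithin ℝ d Q y)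
        Q z := by
      have := ((fderivWithin ℝ d Q y).hasFDerivWithinAt (s := Q) (x := z)).sub_const
        (fderivWithin ℝ d Q y y)
      simpa only [← map_sub] using this
    exact e1.add ((hdz.hasFDerivWithinAt.sub_const (d y)).sub e2)
  have htan : x - z ∈ posTangentConeAt Q z :=
    sub_mem_posTangentConeAt_of_segment_subset (hd.1.segment_subset h.1 hx)
  have h1 := h.2.localize.hasFDerivWithinAt_nonneg hder htan
  simp only [add_apply, sub_apply, pairingCLM_apply, map_sub] at h1
  simp only [bregman, map_sub, pairing_sub_right] at *
  linarith

/-- The regret bound of mirror descent along a deterministic sequence. -/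
theorem sum_pairing_le [ENNReal.HolderConjugate p q] (hd : StrongConvexOn Q 1 d)
    {N : ℕ} (hN : 0 < N) {xs : Vec p n} (hxs : xs ∈ Q) {x : ℕ → Vec p n} {v : ℕ → Vec q n}
    (hx : ∀ k, k ≤ N → x k ∈ Q) (hdiff : ∀ k < N, DifferentiableWithinAt ℝ d Q (x k))
    (hstep : ∀ k < N, IsMirr Q d (x k) (v k) (x (k + 1))) :
    ∑ k ∈ Finset.range N, pairing (v k) (x k - xs) ≤
      bregman Q d xs (x 0) + ∑ k ∈ Finset.range N, ‖v k‖ ^ 2 / 2 := by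
  have key : ∀ m, m < N → ∑ k ∈ Finset.range m, pairing (v k) (x k - xs) + bregman Q d xs (x m) ≤
      bregman Q d xs (x 0) + ∑ k ∈ Finset.range m, ‖v k‖ ^ 2 / 2 := by
    intro m
    induction m with
    | zero => simp
    | succ m ih =>
      intro hm
      have h1 := ih (by omega)
      have h2 := (hstep m (by omega)).pairing_add_bregman_le hd hxs (hx m (by omega))
        (hdiff m (by omega)) (hdiff (m + 1) hm)
      rw [Finset.sum_range_succ, Finset.sum_range_succ]
      linarith
  obtain ⟨m, rfl⟩ : ∃ m, N = m + 1 := ⟨N - 1, by omega⟩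
  have h1 := key m (by omega)
  have h2 := (hstep m (by omega)).pairing_le hd hxs (hx m (by omega)) (hdiff m (by omega))
  rw [Finset.sum_range_succ, Finset.sum_range_succ]
  linarith

/-- A mirror step with the zero vector does not move. -/
theorem IsMirr.eq_of_zero (hd : StrongConvexOn Q 1 d) {y z : Vec p n} {v : Vec q n} (hv : v = 0)
    (hy : y ∈ Q) (hdy : DifferentiableWithinAt ℝ d Q y) (h : IsMirr Q d y v z) : z = y := by
  have h1 : pairing v (z - y) + bregman Q d z y ≤ pairing v (y - y) + bregman Q d y y := h.2 hy
  have h2 := half_sq_le_bregman hd hy h.1 hdy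
  have h3 : ‖z - y‖ ^ 2 ≤ 0 := by
    subst hv
    simp [pairing, bregman_self] at h1
    linarith
  exact sub_eq_zero.1 (norm_eq_zero.1 (pow_eq_zero_iff (two_ne_zero) |>.1
    (le_antisymm h3 (sq_nonneg _))))

end Bregman

section Adapted

variable {Ω E Ξ ι : Type*} [MeasurableSpace E] [MeasurableSpace Ξ]
  {ν : Measure Ξ} [IsProbabilityMeasure ν]

/-- Integrating out an independent variable. -/
theorem lintegral_mul_indep_le {m mΩ : MeasurableSpace Ω} {μ : Measure Ω} [IsProbabilityMeasure μ]
    {X : Ω → E} {Y : Ω → ℝ≥0∞} {η : Ω → Ξ} (hm : m ≤ mΩ) (hX : Measurable[m] X) (hY : Measurable[m] Y)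
    (hη : Measurable η) (hην : μ.map η = ν)
    (hind : Indep m (MeasurableSpace.comap η inferInstance) μ)
    {w : E → Ξ → ℝ≥0∞} (hw : Measurable (Function.uncurry w)) {B : ℝ≥0∞}
    (hB : ∀ ω, ∫⁻ s, w (X ω) s ∂ν ≤ B) :
    ∫⁻ ω, Y ω * w (X ω) (η ω) ∂μ ≤ (∫⁻ ω, Y ω ∂μ) * B := by
  have hX' : Measurable X := hX.mono hm le_rfl
  have hY' : Measurable Y := hY.mono hm le_rfl
  have hXY : Measurable fun ω => (X ω, Y ω) := hX'.prodMk hY'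
  have hind' : (fun ω => (X ω, Y ω)) ⟂ᵢ[μ] η := by
    rw [IndepFun_iff_Indep]
    exact indep_of_indep_of_le_left hind (hX.prodMk hY).comap_le
  have hlaw := (indepFun_iff_map_prod_eq_prod_map_map hXY.aemeasurable hη.aemeasurable).1 hind'
  have hφ : Measurable fun z : (E × ℝ≥0∞) × Ξ => z.1.2 * w z.1.1 z.2 :=
    (measurable_snd.comp measurable_fst).mul
      (hw.comp ((measurable_fst.comp measurable_fst).prodMk measurable_snd))
  calc ∫⁻ ω, Y ω * w (X ω) (η ω) ∂μ
      = ∫⁻ z, z.1.2 * w z.1.1 z.2 ∂(μ.map fun ω => ((X ω, Y ω), η ω)) := by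
        rw [lintegral_map hφ (hXY.prodMk hη)]
    _ = ∫⁻ a, ∫⁻ s, a.2 * w a.1 s ∂ν ∂(μ.map fun ω => (X ω, Y ω)) := by
        rw [hlaw, hην, lintegral_prod _ hφ.aemeasurable]
    _ = ∫⁻ ω, ∫⁻ s, Y ω * w (X ω) s ∂ν ∂μ := by
        rw [lintegral_map _ hXY]
        exact hφ.lintegral_prod_right'
    _ ≤ ∫⁻ ω, Y ω * B ∂μ := by
        refine lintegral_mono fun ω => ?_
        have hwω : Measurable (w (X ω)) := hw.comp measurable_prodMk_left
        rw [lintegral_const_mul _ hwω]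
        exact mul_le_mul_right (hB ω) _
    _ = (∫⁻ ω, Y ω ∂μ) * B := lintegral_mul_const _ hY'

variable [LinearOrder ι] [MeasurableSpace Ω] {μ : Measure Ω}

/-- The `σ`-algebra generated by the variables with index below `a`. -/
abbrev past (ξ : ι → Ω → Ξ) (a : ι) : MeasurableSpace Ω :=
  ⨆ b : ι, ⨆ _ : b < a, MeasurableSpace.comap (ξ b) inferInstance

theorem past_le {ξ : ι → Ω → Ξ} (hξ : ∀ a, Measurable (ξ a)) (a : ι) :
    past ξ a ≤ ‹MeasurableSpace Ω› :=
  iSup₂_le fun b _ => (hξ b).comap_le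

theorem indep_past {ξ : ι → Ω → Ξ} (hξ : ∀ a, Measurable (ξ a)) (hind : iIndepFun ξ μ) (a : ι) :
    Indep (past ξ a) (MeasurableSpace.comap (ξ a) inferInstance) μ := by
  have h := indep_iSup_of_disjoint (fun b => (hξ b).comap_le)
    ((iIndepFun_iff_iIndep _ _ _).1 hind) (S := {b | b < a}) (T := {a}) (by simp)
  simpa [past] using h

variable [IsProbabilityMeasure μ]

/-- The expectation of a product of functions of adapted points and fresh samples is bounded by
the product of the bounds for frozen points. -/
theorem lintegral_prod_adapted_le {ξ : ι → Ω → Ξ} (hξ : ∀ a, Measurable (ξ a))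
    (hlaw : ∀ a, μ.map (ξ a) = ν) (hind : iIndepFun ξ μ) {X : ι → Ω → E}
    (hX : ∀ a, Measurable[past ξ a] (X a)) {w : E → Ξ → ℝ≥0∞}
    (hw : Measurable (Function.uncurry w)) {B : ℝ≥0∞}
    (hB : ∀ a ω, ∫⁻ s, w (X a ω) s ∂ν ≤ B) (S : Finset ι) :
    ∫⁻ ω, ∏ a ∈ S, w (X a ω) (ξ a ω) ∂μ ≤ B ^ S.card := by
  induction S using Finset.induction_on_max with
  | empty => simp
  | insert a S hmax ih =>
    have ha : a ∉ S := fun h => lt_irrefl _ (hmax a h)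
    have hY : Measurable[past ξ a] fun ω => ∏ b ∈ S, w (X b ω) (ξ b ω) := by
      refine Finset.measurable_fun_prod S fun b hb => ?_
      have h1 : Measurable[past ξ a] (X b) := (hX b).mono
        (iSup₂_le fun c hc => le_iSup₂_of_le c (hc.trans (hmax b hb)) le_rfl) le_rfl
      have h2 : Measurable[past ξ a] (ξ b) :=
        (comap_measurable (ξ b)).mono (le_iSup₂_of_le b (hmax b hb) le_rfl) le_rfl
      exact hw.comp (h1.prodMk h2)
    have h := lintegral_mul_indep_le (past_le hξ a) (hX a) hY (hξ a) (hlaw a)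
      (indep_past hξ hind a) hw (hB a)
    simp_rw [Finset.prod_insert ha, Finset.card_insert_of_notMem ha, pow_succ,
      mul_comm (w (X a _) (ξ a _))]
    exact h.trans (mul_le_mul_left ih _)

/-- The law of a function of an adapted point and the fresh sample. -/
theorem measure_adapted_le {ξ : ι → Ω → Ξ} (hξ : ∀ a, Measurable (ξ a))
    (hlaw : ∀ a, μ.map (ξ a) = ν) (hind : iIndepFun ξ μ) {X : ι → Ω → E}
    (hX : ∀ a, Measurable[past ξ a] (X a)) {S : Set (E × Ξ)} (hS : MeasurableSet S) {δ : ℝ≥0∞}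
    (hδ : ∀ a ω, ν {s | (X a ω, s) ∈ S} ≤ δ) (a : ι) :
    μ {ω | (X a ω, ξ a ω) ∈ S} ≤ δ := by
  have hX' : Measurable (X a) := (hX a).mono (past_le hξ a) le_rfl
  have h := lintegral_prod_adapted_le (w := fun x s => S.indicator 1 (x, s)) hξ hlaw hind hX
    (measurable_one.indicator hS) (B := δ) (fun a ω => ?_) {a}
  · simp only [Finset.prod_singleton, Finset.card_singleton, pow_one] at h
    refine le_trans (le_of_eq ?_) h
    exact (lintegral_indicator_one (hS.preimage (hX'.prodMk (hξ a)))).symm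
  · refine le_trans (le_of_eq ?_) (hδ a ω)
    exact lintegral_indicator_one (hS.preimage measurable_prodMk_left)

/-- Markov's inequality for the exponential of a sum over an adapted sequence, on the event that no
sample is exceptional. -/
theorem measure_sum_gt_le [Fintype ι] {ξ : ι → Ω → Ξ} (hξ : ∀ a, Measurable (ξ a))
    (hlaw : ∀ a, μ.map (ξ a) = ν) (hind : iIndepFun ξ μ) {X : ι → Ω → E}
    (hX : ∀ a, Measurable[past ξ a] (X a)) {W : E → Ξ → ℝ} (hW : Measurable (Function.uncurry W))
    {S : Set (E × Ξ)} (hS : MeasurableSet S) {b δ θ : ℝ} (hδ0 : 0 ≤ δ)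
    (hb : ∀ a ω, ∫⁻ s in {s | (X a ω, s) ∉ S}, ENNReal.ofReal (Real.exp (W (X a ω) s)) ∂ν ≤
      ENNReal.ofReal (Real.exp b))
    (hδ : ∀ a ω, ν {s | (X a ω, s) ∈ S} ≤ ENNReal.ofReal δ) :
    ∃ bad : Set Ω, MeasurableSet bad ∧
      μ.real bad ≤ Fintype.card ι * δ + Real.exp (Fintype.card ι * b - θ) ∧
      ∀ ω ∉ bad, ∑ a, W (X a ω) (ξ a ω) < θ := by
  have hX' : ∀ a, Measurable (X a) := fun a => (hX a).mono (past_le hξ a) le_rfl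
  set w : E → Ξ → ℝ≥0∞ := fun x s =>
    Sᶜ.indicator (fun z => ENNReal.ofReal (Real.exp (W z.1 z.2))) (x, s) with hwdef
  have hw : Measurable (Function.uncurry w) :=
    (hW.exp.ennreal_ofReal).indicator hS.compl
  have hprod := lintegral_prod_adapted_le hξ hlaw hind hX hw (B := ENNReal.ofReal (Real.exp b))
    (fun a ω => by
      refine le_trans (le_of_eq ?_) (hb a ω)
      exact lintegral_indicator (hS.compl.preimage measurable_prodMk_left)
        fun s => ENNReal.ofReal (Real.exp (W (X a ω) s))) Finset.univ
  have hPm : Measurable fun ω => ∏ a, w (X a ω) (ξ a ω) :=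
    Finset.measurable_fun_prod _ fun a _ => hw.comp ((hX' a).prodMk (hξ a))
  set bad₁ : Set Ω := ⋃ a, {ω | (X a ω, ξ a ω) ∈ S}
  set bad₂ : Set Ω := {ω | ENNReal.ofReal (Real.exp θ) ≤ ∏ a, w (X a ω) (ξ a ω)}
  have h1 : μ bad₁ ≤ ENNReal.ofReal (Fintype.card ι * δ) := by
    refine (measure_iUnion_fintype_le μ _).trans ?_
    refine (Finset.sum_le_sum fun a _ => measure_adapted_le hξ hlaw hind hX hS hδ a).trans ?_
    simp [ENNReal.ofReal_mul]
  have h2 : μ bad₂ ≤ ENNReal.ofReal (Real.exp (Fintype.card ι * b - θ)) := by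
    refine (meas_ge_le_lintegral_div hPm.aemeasurable
      (by simpa using Real.exp_pos θ) ENNReal.ofReal_ne_top).trans ?_
    rw [Real.exp_sub, ENNReal.ofReal_div_of_pos (Real.exp_pos θ), Real.exp_nat_mul,
      ENNReal.ofReal_pow (Real.exp_pos b).le]
    exact ENNReal.div_le_div_right hprod _
  refine ⟨bad₁ ∪ bad₂, ?_, ?_, fun ω hω => ?_⟩
  · exact (MeasurableSet.iUnion fun a => hS.preimage ((hX' a).prodMk (hξ a))).union
      (measurableSet_le measurable_const hPm)
  · refine (measureReal_union_le _ _).trans (add_le_add ?_ ?_)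
    · exact ENNReal.toReal_le_of_le_ofReal (by positivity) h1
    · exact ENNReal.toReal_le_of_le_ofReal (by positivity) h2
  · simp only [Set.mem_union, not_or, bad₁, bad₂, Set.mem_iUnion, Set.mem_ofPred_eq, not_exists,
      not_le] at hω
    have hweq : ∀ a, w (X a ω) (ξ a ω) = ENNReal.ofReal (Real.exp (W (X a ω) (ξ a ω))) :=
      fun a => Set.indicator_of_mem (s := Sᶜ) (hω.1 a) _
    have h3 := hω.2
    simp_rw [hweq] at h3
    rw [← ENNReal.ofReal_prod_of_nonneg fun a _ => (Real.exp_pos _).le, ← Real.exp_sum,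
      ENNReal.ofReal_lt_ofReal_iff (Real.exp_pos θ), Real.exp_lt_exp] at h3
    exact h3

end Adapted

section Moments

theorem exp_le_add_exp_sq (x : ℝ) : Real.exp x ≤ x + Real.exp (x ^ 2) := by
  have h1 := Real.add_one_le_exp (x ^ 2)
  rcases le_or_gt |x| 1 with hx | hx
  · have := (abs_le.1 (Real.abs_exp_sub_one_sub_id_le hx)).2
    linarith
  · rcases lt_abs.1 hx with hx | hx
    · have : Real.exp x ≤ Real.exp (x ^ 2) := Real.exp_le_exp.2 (by nlinarith)
      linarith
    · have : Real.exp x ≤ 1 := Real.exp_le_one_iff.2 (by linarith)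
      nlinarith

theorem exp_half_add_le (x y : ℝ) :
    Real.exp ((x + y) / 2) ≤ (Real.exp x + Real.exp y) / 2 := by
  have hx : Real.exp x = Real.exp (x / 2) ^ 2 := by rw [← Real.exp_nat_mul]; congr 1; push_cast; ring
  have hy : Real.exp y = Real.exp (y / 2) ^ 2 := by rw [← Real.exp_nat_mul]; congr 1; push_cast; ring
  rw [add_div, Real.exp_add, hx, hy]
  nlinarith [sq_nonneg (Real.exp (x / 2) - Real.exp (y / 2))]

/-- The exponential lies below its chord. -/
theorem exp_mul_le {a v : ℝ} (ha0 : 0 ≤ a) (ha1 : a ≤ 1) :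
    Real.exp (a * v) ≤ Real.exp a * (1 - a + a * Real.exp (v - 1)) := by
  have h := convexOn_exp.2 (Set.mem_univ 0) (Set.mem_univ (v - 1)) (sub_nonneg.2 ha1) ha0
    (by ring)
  simp only [smul_eq_mul, mul_zero, zero_add, Real.exp_zero, mul_one] at h
  calc Real.exp (a * v) = Real.exp a * Real.exp (a * (v - 1)) := by
        rw [← Real.exp_add]; congr 1; ring
    _ ≤ _ := by gcongr

variable {Ξ : Type*} [MeasurableSpace Ξ] {ν : Measure Ξ} [IsProbabilityMeasure ν]

theorem abs_integral_le_one_of_sq {U Y : Ξ → ℝ} (hv : Integrable (fun s => U s ^ 2) ν)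
    (hv1 : ∫ s, U s ^ 2 ∂ν ≤ 1) (hYU : ∀ s, |Y s| ≤ U s) : |∫ s, Y s ∂ν| ≤ 1 := by
  have hi : Integrable (fun s => (1 + U s ^ 2) / 2) ν := ((integrable_const 1).add hv).div_const 2
  have h : ∫ s, (1 + U s ^ 2) / 2 ∂ν ≤ 1 := by
    rw [integral_div, integral_add (integrable_const _) hv]
    simp only [integral_const, probReal_univ, smul_eq_mul]
    linarith
  rw [← Real.norm_eq_abs]
  refine le_trans (norm_integral_le_of_norm_le hi
    (Filter.Eventually.of_forall fun s => ?_)) h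
  rw [Real.norm_eq_abs]
  nlinarith [hYU s, sq_nonneg (1 - U s)]

/-- The exponential moment of one step in the sub-Gaussian regime. -/
theorem lintegral_exp_le_of_subGaussian {U Y : Ξ → ℝ} (hU : Measurable U)
    (hexp : ∫⁻ s, ENNReal.ofReal (Real.exp (U s ^ 2)) ∂ν ≤ ENNReal.ofReal (Real.exp 1))
    (hY : Integrable Y ν) (hYU : ∀ s, |Y s| ≤ U s) {T : ℝ} (hT : 1 ≤ T) :
    ∫⁻ s, ENNReal.ofReal (Real.exp (1 / 4 * (U s ^ 2 / T ^ 2 + (∫ r, Y r ∂ν - Y s) / T))) ∂ν ≤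
      ENNReal.ofReal (Real.exp (1 / T ^ 2)) := by
  have hint : Integrable (fun s => Real.exp (U s ^ 2)) ν := by
    refine ⟨(hU.pow_const 2).exp.aestronglyMeasurable, ?_⟩
    rw [hasFiniteIntegral_iff_ofReal (Filter.Eventually.of_forall fun s => (Real.exp_pos _).le)]
    exact hexp.trans_lt ENNReal.ofReal_lt_top
  have hint1 : ∫ s, Real.exp (U s ^ 2) ∂ν ≤ Real.exp 1 := by
    rw [integral_eq_lintegral_of_nonneg_ae (Filter.Eventually.of_forall fun s => (Real.exp_pos _).le)
      hint.aestronglyMeasurable]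
    exact ENNReal.toReal_le_of_le_ofReal (Real.exp_pos 1).le hexp
  have hE : Integrable (fun s => Real.exp (U s ^ 2 - 1)) ν := by
    simpa only [Real.exp_sub] using hint.div_const (Real.exp 1)
  have hE1 : ∫ s, Real.exp (U s ^ 2 - 1) ∂ν ≤ 1 := by
    simp only [Real.exp_sub]
    rw [integral_div]
    exact (div_le_one (Real.exp_pos 1)).2 hint1
  have hle : ∀ s, U s ^ 2 ≤ Real.exp (U s ^ 2 - 1) := fun s => by
    linarith [Real.add_one_le_exp (U s ^ 2 - 1)]
  have hv : Integrable (fun s => U s ^ 2) ν :=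
    hE.mono' (hU.pow_const 2).aestronglyMeasurable (Filter.Eventually.of_forall fun s => by
      rw [Real.norm_of_nonneg (sq_nonneg _)]; exact hle s)
  have hm := abs_integral_le_one_of_sq hv ((integral_mono hv hE hle).trans hE1) hYU
  set m := ∫ r, Y r ∂ν with hmdef
  set a : ℝ := 1 / (2 * T ^ 2) with ha
  have hT2 : 1 ≤ T ^ 2 := one_le_pow₀ hT
  have ha0 : 0 ≤ a := by positivity
  have ha1 : a ≤ 1 := by
    rw [ha, div_le_one (by positivity)]; linarith
  set H : Ξ → ℝ := fun s =>
    Real.exp (2 * a) * (1 - a + a * Real.exp (U s ^ 2 - 1)) + 1 / (4 * T) * (m - Y s) with hH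
  have hpt : ∀ s, Real.exp (1 / 4 * (U s ^ 2 / T ^ 2 + (m - Y s) / T)) ≤ H s := by
    intro s
    have e1 := exp_half_add_le (a * U s ^ 2) (1 / (2 * T) * (m - Y s))
    have e2 : (a * U s ^ 2 + 1 / (2 * T) * (m - Y s)) / 2 =
        1 / 4 * (U s ^ 2 / T ^ 2 + (m - Y s) / T) := by
      rw [ha]; field_simp; ring
    rw [e2] at e1
    have e3 := exp_mul_le (v := U s ^ 2) ha0 ha1
    have e4 := exp_le_add_exp_sq (1 / (2 * T) * (m - Y s))
    have e5 : (m - Y s) ^ 2 ≤ 2 * U s ^ 2 + 2 := by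
      have h1 : m ^ 2 ≤ 1 := (sq_le_one_iff_abs_le_one m).2 hm
      have h2 : Y s ^ 2 ≤ U s ^ 2 := sq_le_sq' (abs_le.1 (hYU s)).1 (abs_le.1 (hYU s)).2
      nlinarith [sq_nonneg (m + Y s)]
    have e6 : (1 / (2 * T) * (m - Y s)) ^ 2 ≤ a * U s ^ 2 + a := by
      have : (1 / (2 * T) * (m - Y s)) ^ 2 = a / 2 * (m - Y s) ^ 2 := by
        rw [ha]; field_simp
      rw [this]
      nlinarith
    have e7 : Real.exp ((1 / (2 * T) * (m - Y s)) ^ 2) ≤ Real.exp a * Real.exp (a * U s ^ 2) := by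
      rw [← Real.exp_add]
      exact Real.exp_le_exp.2 (by linarith)
    have e8 : Real.exp a * Real.exp (a * U s ^ 2) ≤
        Real.exp (2 * a) * (1 - a + a * Real.exp (U s ^ 2 - 1)) := by
      rw [two_mul, Real.exp_add, mul_assoc]
      gcongr
    have e9 : Real.exp (a * U s ^ 2) ≤ Real.exp a * Real.exp (a * U s ^ 2) :=
      le_mul_of_one_le_left (Real.exp_pos _).le (Real.one_le_exp ha0)
    have e10 : 1 / (2 * T) * (m - Y s) = 2 * (1 / (4 * T) * (m - Y s)) := by
      field_simp; ring
    rw [hH]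
    simp only
    linarith
  have hi1 : Integrable (fun s => a * Real.exp (U s ^ 2 - 1)) ν := hE.const_mul a
  have hi2 : Integrable (fun s => Real.exp (2 * a) * (1 - a + a * Real.exp (U s ^ 2 - 1))) ν :=
    ((integrable_const (1 - a)).add hi1).const_mul _
  have hi3 : Integrable (fun s => 1 / (4 * T) * (m - Y s)) ν :=
    ((integrable_const m).sub hY).const_mul _
  have hHint : Integrable H ν := hi2.add hi3
  have hHle : ∫ s, H s ∂ν ≤ Real.exp (1 / T ^ 2) := by
    simp only [hH]
    rw [integral_add hi2 hi3, integral_const_mul, integral_const_mul,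
      integral_sub (integrable_const m) hY, integral_add (integrable_const _) hi1,
      integral_const_mul]
    simp only [integral_const, probReal_univ, smul_eq_mul, one_mul, ← hmdef, sub_self, mul_zero,
      add_zero]
    have : 2 * a = 1 / T ^ 2 := by rw [ha]; field_simp
    rw [this]
    exact mul_le_of_le_one_right (Real.exp_pos _).le (by nlinarith)
  calc _ ≤ ∫⁻ s, ENNReal.ofReal (H s) ∂ν :=
        lintegral_mono fun s => ENNReal.ofReal_le_ofReal (hpt s)
    _ = ENNReal.ofReal (∫ s, H s ∂ν) := (ofReal_integral_eq_lintegral_ofReal hHint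
        (Filter.Eventually.of_forall fun s => (Real.exp_pos _).le.trans (hpt s))).symm
    _ ≤ _ := ENNReal.ofReal_le_ofReal hHle

theorem integrable_sq_of_tail {U : Ξ → ℝ} (hU : Measurable U) {α : ℝ} (hα : 2 < α)
    (htail : ∀ t : ℝ, 0 ≤ t → ν.real {s | t ≤ U s ^ 2} ≤ (1 + t) ^ (-α)) :
    Integrable (fun s => U s ^ 2) ν ∧ ∫ s, U s ^ 2 ∂ν ≤ 1 := by
  have hderiv : ∀ t ∈ Set.Ici (0 : ℝ),
      HasDerivAt (fun t : ℝ => -(1 + t)⁻¹) (((1 + t) ^ 2)⁻¹) t := by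
    intro t ht
    have ht' : (1 + t) ≠ 0 := by have : 0 ≤ t := ht; positivity
    have := (((hasDerivAt_id t).const_add 1).inv ht').neg
    exact this.congr_deriv (by simp [neg_div])
  have hlim : Filter.Tendsto (fun t : ℝ => -(1 + t)⁻¹) Filter.atTop (nhds 0) := by
    simpa using (tendsto_inv_atTop_zero.comp
      (Filter.tendsto_atTop_add_const_left Filter.atTop (1 : ℝ) Filter.tendsto_id)).neg
  have hint : IntegrableOn (fun t : ℝ => ((1 + t) ^ 2)⁻¹) (Set.Ioi 0) :=
    integrableOn_Ioi_deriv_of_nonneg' hderiv (fun t _ => by positivity) hlim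
  have hval : ∫ t in Set.Ioi (0 : ℝ), ((1 + t) ^ 2)⁻¹ = 1 := by
    rw [integral_Ioi_of_hasDerivAt_of_nonneg' hderiv (fun t _ => by positivity) hlim]
    norm_num
  have hl : ∫⁻ s, ENNReal.ofReal (U s ^ 2) ∂ν ≤ 1 := by
    rw [lintegral_eq_lintegral_meas_le ν (Filter.Eventually.of_forall fun s => sq_nonneg _)
      (hU.pow_const 2).aemeasurable]
    calc _ ≤ ∫⁻ t in Set.Ioi (0 : ℝ), ENNReal.ofReal (((1 + t) ^ 2)⁻¹) := by
          refine setLIntegral_mono' measurableSet_Ioi fun t ht => ?_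
          have ht' : (0 : ℝ) < t := ht
          rw [← ofReal_measureReal]
          refine ENNReal.ofReal_le_ofReal ((htail t ht'.le).trans ?_)
          have h2 : ((1 + t) ^ 2)⁻¹ = (1 + t) ^ (-2 : ℝ) := by
            rw [Real.rpow_neg (by positivity)]; norm_num
          rw [h2]
          exact Real.rpow_le_rpow_of_exponent_le (by linarith) (by linarith)
      _ = ENNReal.ofReal (∫ t in Set.Ioi (0 : ℝ), ((1 + t) ^ 2)⁻¹) :=
          (ofReal_integral_eq_lintegral_ofReal hint
            (Filter.Eventually.of_forall fun t => by positivity)).symm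
      _ = 1 := by rw [hval, ENNReal.ofReal_one]
  refine ⟨⟨(hU.pow_const 2).aestronglyMeasurable, ?_⟩, ?_⟩
  · rw [hasFiniteIntegral_iff_ofReal (Filter.Eventually.of_forall fun s => sq_nonneg _)]
    exact hl.trans_lt ENNReal.one_lt_top
  · rw [integral_eq_lintegral_of_nonneg_ae (Filter.Eventually.of_forall fun s => sq_nonneg _)
      (hU.pow_const 2).aestronglyMeasurable]
    exact ENNReal.toReal_le_of_le_ofReal zero_le_one (by simpa using hl)

/-- The truncated exponential moment of one step in the heavy-tail regime. -/
theorem setLIntegral_exp_le_of_tail {U Y : Ξ → ℝ} (hU : Measurable U) {α : ℝ} (hα : 2 < α)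
    (htail : ∀ t : ℝ, 0 ≤ t → ν.real {s | t ≤ U s ^ 2} ≤ (1 + t) ^ (-α))
    (hY : Integrable Y ν) (hYU : ∀ s, |Y s| ≤ U s) {T L : ℝ} (hT : 1 ≤ T) (hL : 1 ≤ L)
    (hsmall : Real.exp (3 / 10 * L) * (1 + T ^ 2) ^ (-α) ≤ 1 / T ^ 2) :
    ∫⁻ s in {s | ¬ L * T ^ 2 < U s ^ 2},
        ENNReal.ofReal (Real.exp (1 / 10 * (U s ^ 2 / T ^ 2 + (∫ r, Y r ∂ν - Y s) / T))) ∂ν ≤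
      ENNReal.ofReal (Real.exp (2 / T ^ 2)) := by
  obtain ⟨hv, hv1⟩ := integrable_sq_of_tail hU hα htail
  have hm := abs_integral_le_one_of_sq hv hv1 hYU
  set m := ∫ r, Y r ∂ν with hmdef
  have hT0 : 0 < T := by linarith
  set big : Set Ξ := {s | T ^ 2 ≤ U s ^ 2} with hbig
  have hbigm : MeasurableSet big := measurableSet_le measurable_const (hU.pow_const 2)
  set H : Ξ → ℝ := fun s => (1 + 2 / 100 / T ^ 2 + 38 / 100 / T ^ 2 * U s ^ 2 +
    1 / (10 * T) * (m - Y s)) + big.indicator (fun _ => Real.exp (3 / 10 * L)) s with hH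
  have hD : ∀ s, |m - Y s| ≤ U s + 1 := fun s =>
    (abs_sub m (Y s)).trans (by linarith [hYU s])
  have hpt : ∀ s, 0 ≤ H s ∧ (¬ L * T ^ 2 < U s ^ 2 →
      Real.exp (1 / 10 * (U s ^ 2 / T ^ 2 + (m - Y s) / T)) ≤ H s) := by
    intro s
    have hU0 : 0 ≤ U s := (abs_nonneg _).trans (hYU s)
    obtain ⟨r, hr⟩ : ∃ r, r = U s / T := ⟨_, rfl⟩
    obtain ⟨D, hDd⟩ : ∃ D, D = (m - Y s) / T := ⟨_, rfl⟩
    obtain ⟨w, hw⟩ : ∃ w, w = 1 / T := ⟨_, rfl⟩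
    have hr0 : 0 ≤ r := by rw [hr]; positivity
    have hw0 : 0 < w := by rw [hw]; positivity
    have hw1 : w ≤ 1 := by rw [hw, div_le_one hT0]; exact hT
    have hDle : |D| ≤ r + w := by
      rw [hDd, hr, hw, ← add_div, abs_div, abs_of_pos hT0]
      gcongr
      exact hD s
    have hDle1 := (abs_le.1 hDle).1
    have hDle2 := (abs_le.1 hDle).2
    have hrU : U s ^ 2 / T ^ 2 = r ^ 2 := by rw [hr, div_pow]
    have hHs : H s = (1 + 2 / 100 * w ^ 2 + 38 / 100 * r ^ 2 + 1 / 10 * D) +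
        big.indicator (fun _ => Real.exp (3 / 10 * L)) s := by
      rw [hH, hr, hDd, hw]; simp only; field_simp
    rw [hHs, hrU, ← hDd]
    by_cases hs : s ∈ big
    · have hr1 : 1 ≤ r := by
        rw [hr, one_le_div hT0]
        exact le_of_sq_le_sq hs hU0
      rw [Set.indicator_of_mem hs]
      have hnn : 0 ≤ 1 + 2 / 100 * w ^ 2 + 38 / 100 * r ^ 2 + 1 / 10 * D := by nlinarith
      refine ⟨by positivity, fun hle => le_add_of_nonneg_of_le hnn (Real.exp_le_exp.2 ?_)⟩
      have hrL : r ^ 2 ≤ L := by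
        rw [← hrU, div_le_iff₀ (by positivity)]
        exact not_lt.1 hle
      nlinarith
    · have hr1 : r ≤ 1 := by
        rw [hr, div_le_one hT0]
        exact le_of_sq_le_sq (not_le.1 hs).le hT0.le
      rw [Set.indicator_of_notMem hs, add_zero]
      refine ⟨by nlinarith, fun _ => ?_⟩
      have hWle : |1 / 10 * (r ^ 2 + D)| ≤ 1 / 10 * (2 * r + w) := by
        rw [abs_mul, abs_of_pos (by norm_num : (0 : ℝ) < 1 / 10)]
        gcongr
        exact abs_le.2 ⟨by nlinarith, by nlinarith⟩
      have h1 := (abs_le.1 (Real.abs_exp_sub_one_sub_id_le (hWle.trans (by linarith)))).2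
      have h2 : (1 / 10 * (r ^ 2 + D)) ^ 2 ≤ (1 / 10 * (2 * r + w)) ^ 2 :=
        sq_le_sq' (by linarith [(abs_le.1 hWle).1]) (abs_le.1 hWle).2
      nlinarith [sq_nonneg (2 * r - w)]
  have hint1 : Integrable (fun s => 1 + 2 / 100 / T ^ 2 + 38 / 100 / T ^ 2 * U s ^ 2) ν :=
    (integrable_const _).add (hv.const_mul _)
  have hint2 : Integrable (fun s => 1 / (10 * T) * (m - Y s)) ν :=
    ((integrable_const m).sub hY).const_mul _
  have hint3 : Integrable (big.indicator fun _ => Real.exp (3 / 10 * L)) ν :=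
    (integrable_const _).indicator hbigm
  have hint4 : Integrable (fun s => 1 + 2 / 100 / T ^ 2 + 38 / 100 / T ^ 2 * U s ^ 2 +
      1 / (10 * T) * (m - Y s)) ν := hint1.add hint2
  have hHint : Integrable H ν := hint4.add hint3
  have hHle : ∫ s, H s ∂ν ≤ Real.exp (2 / T ^ 2) := by
    have e : ∫ s, H s ∂ν = 1 + 2 / 100 / T ^ 2 + 38 / 100 / T ^ 2 * ∫ s, U s ^ 2 ∂ν +
        Real.exp (3 / 10 * L) * ν.real big := by
      simp only [hH]
      rw [integral_add hint4 hint3, integral_add hint1 hint2,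
        integral_add (integrable_const _) (hv.const_mul _), integral_const_mul, integral_const_mul,
        integral_sub (integrable_const m) hY, integral_indicator_const _ hbigm]
      simp [← hmdef, mul_comm]
    have h1 : Real.exp (3 / 10 * L) * ν.real big ≤ 1 / T ^ 2 :=
      le_trans (by gcongr; exact htail _ (sq_nonneg T)) hsmall
    have h2 : 38 / 100 / T ^ 2 * ∫ s, U s ^ 2 ∂ν ≤ 38 / 100 / T ^ 2 :=
      mul_le_of_le_one_right (by positivity) hv1
    have h3 := Real.add_one_le_exp (2 / T ^ 2)
    have h4 : 0 < 1 / T ^ 2 := by positivity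
    have e1 : 2 / 100 / T ^ 2 = 2 / 100 * (1 / T ^ 2) := by ring
    have e2 : 38 / 100 / T ^ 2 = 38 / 100 * (1 / T ^ 2) := by ring
    have e3 : 2 / T ^ 2 = 2 * (1 / T ^ 2) := by ring
    rw [e]
    linarith
  calc _ ≤ ∫⁻ s in {s | ¬ L * T ^ 2 < U s ^ 2}, ENNReal.ofReal (H s) ∂ν := by
        refine setLIntegral_mono' (measurableSet_lt measurable_const (hU.pow_const 2)).compl
          fun s hs => ENNReal.ofReal_le_ofReal ((hpt s).2 hs)
    _ ≤ ∫⁻ s, ENNReal.ofReal (H s) ∂ν := setLIntegral_le_lintegral _ _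
    _ = ENNReal.ofReal (∫ s, H s ∂ν) := (ofReal_integral_eq_lintegral_ofReal hHint
        (Filter.Eventually.of_forall fun s => (hpt s).1)).symm
    _ ≤ _ := ENNReal.ofReal_le_ofReal hHle

end Moments

section

variable {p q : ℝ≥0∞} {n : ℕ} [Fact (1 ≤ p)]
  {Q : Set (Vec p n)} {d : Vec p n → ℝ} {x₀ xs : Vec p n}

/-- The total optimality gap along one run of mirror descent with stochastic subgradients `g k` of
mean `gbar k`. -/
theorem sum_gap_le [Fact (1 ≤ q)] [ENNReal.HolderConjugate p q] (hd : StrongConvexOn Q 1 d)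
    {N : ℕ} (hN : 0 < N) (hxs : xs ∈ Q) {f : Vec p n → ℝ} {x : ℕ → Vec p n} {g gbar : Fin N → Vec q n}
    (hx : ∀ k, k ≤ N → x k ∈ Q) (hdiff : ∀ k < N, DifferentiableWithinAt ℝ d Q (x k))
    {R D M : ℝ} (hR : R = √(bregman Q d xs (x 0))) (hR0 : 0 < R) (hRD : R ≤ D) (hM : 0 < M)
    (hstep : ∀ k : Fin N, IsMirr Q d (x k) ((R / M * √(2 / N)) • g k) (x (k + 1)))
    (hsub : ∀ k : Fin N, f (x k) - f xs ≤ pairing (gbar k) (x k - xs)) :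
    ∑ k : Fin N, (f (x k) - f xs) ≤ M * D * √N * (1 + ∑ k : Fin N, ((‖g k‖ / M) ^ 2 / √N ^ 2 +
      (pairing (gbar k) (x k - xs) / (M * D) - pairing (g k) (x k - xs) / (M * D)) / √N)) := by
  have hT0 : 0 < √(N : ℝ) := Real.sqrt_pos.2 (by exact_mod_cast hN)
  have hD0 : 0 < D := hR0.trans_le hRD
  have hR2 : bregman Q d xs (x 0) = R ^ 2 := by
    rw [hR, Real.sq_sqrt]
    exact le_trans (by positivity) (half_sq_le_bregman hd (hx 0 (by omega)) hxs (hdiff 0 hN))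
  have hr : √(2 : ℝ) ^ 2 = 2 := Real.sq_sqrt (by norm_num)
  have hr0 : 0 < √(2 : ℝ) := by positivity
  obtain ⟨h, hh⟩ : ∃ h, h = R / M * √(2 / N) := ⟨_, rfl⟩
  have hh' : h = R * √2 / (M * √N) := by
    rw [hh, Real.sqrt_div (by norm_num)]; field_simp
  have hh0 : 0 < h := by rw [hh']; positivity
  rw [← hh] at hstep
  have hreg := sum_pairing_le hd hN hxs (v := fun k => if hk : k < N then h • g ⟨k, hk⟩ else 0)
    hx hdiff (fun k hk => by simpa [hk] using hstep ⟨k, hk⟩)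
  rw [Finset.sum_range, Finset.sum_range, hR2] at hreg
  simp only [Fin.is_lt, dite_true, Fin.eta, pairing_smul_left, norm_smul,
    Real.norm_of_nonneg hh0.le] at hreg
  have hsum : ∑ k : Fin N, pairing (g k) (x k - xs) ≤
      M * D * √N + ∑ k : Fin N, M * D * √N * ((‖g k‖ / M) ^ 2 / √N ^ 2) := by
    have e1 : R ^ 2 ≤ h * (M * D * √N) := by
      have : h * (M * D * √N) = √2 * (R * D) := by rw [hh']; field_simp
      rw [this]
      nlinarith [Real.one_lt_sqrt_two, mul_pos hR0 hD0]
    have e2 : ∑ k : Fin N, (h * ‖g k‖) ^ 2 / 2 ≤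
        h * ∑ k : Fin N, M * D * √N * ((‖g k‖ / M) ^ 2 / √N ^ 2) := by
      rw [Finset.mul_sum]
      refine Finset.sum_le_sum fun k _ => ?_
      have e3 : (h * ‖g k‖) ^ 2 / 2 = h * ‖g k‖ ^ 2 / (M * √N) * (R * √2 / 2) := by
        rw [mul_pow, pow_two h]; nth_rw 2 [hh']; field_simp
      have e4 : h * (M * D * √N * ((‖g k‖ / M) ^ 2 / √N ^ 2)) =
          h * ‖g k‖ ^ 2 / (M * √N) * D := by field_simp
      rw [e3, e4]
      gcongr
      nlinarith
    refine le_of_mul_le_mul_left ?_ hh0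
    rw [mul_add]
    refine le_trans (le_of_eq ?_) (hreg.trans (add_le_add e1 e2))
    rw [Finset.mul_sum]
  calc ∑ k : Fin N, (f (x k) - f xs)
      ≤ ∑ k : Fin N, pairing (gbar k) (x k - xs) := Finset.sum_le_sum fun k _ => hsub k
    _ = ∑ k : Fin N, pairing (g k) (x k - xs) +
        ∑ k : Fin N, (pairing (gbar k) (x k - xs) - pairing (g k) (x k - xs)) := by
        rw [← Finset.sum_add_distrib]; exact Finset.sum_congr rfl fun k _ => by ring
    _ ≤ _ := add_le_add_left hsum _
    _ = _ := by
        rw [mul_add, mul_one, Finset.mul_sum, add_assoc, ← Finset.sum_add_distrib]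
        congr 1
        refine Finset.sum_congr rfl fun k _ => ?_
        field_simp

theorem IsTrajectory.mem {Ω Ξ : Type*} [MeasurableSpace Ξ] {G : Vec p n → Ξ → Vec q n} {h : ℝ}
    {N : ℕ} {ξ : Fin N → Ω → Ξ} {x : ℕ → Ω → Vec p n} (hx₀ : x₀ ∈ Q)
    (ht : IsTrajectory Q d x₀ G h N ξ x) {k : ℕ} (hk : k ≤ N) (ω : Ω) : x k ω ∈ Q := by
  cases k with
  | zero => rw [ht.start]; exact hx₀
  | succ k => exact (ht.step ⟨k, by omega⟩ ω).1

/-- With step size zero the trajectory stays at its starting point. -/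
theorem IsTrajectory.eq_start {Ω Ξ : Type*} [MeasurableSpace Ξ] {G : Vec p n → Ξ → Vec q n} {h : ℝ}
    {N : ℕ} {ξ : Fin N → Ω → Ξ} {x : ℕ → Ω → Vec p n} (hd : StrongConvexOn Q 1 d) (hx₀ : x₀ ∈ Q)
    (ht : IsTrajectory Q d x₀ G h N ξ x) (hh : h = 0) {k : ℕ} (hk : k ≤ N) (ω : Ω) :
    x k ω = x₀ := by
  induction k with
  | zero => exact ht.start ω
  | succ k ih =>
    rw [(ht.step ⟨k, by omega⟩ ω).eq_of_zero hd (by simp [hh]) (ht.mem hx₀ (by omega) ω)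
      (ht.diff k (by omega) ω)]
    exact ih (by omega)

omit [Fact (1 ≤ p)] in
/-- The gap at the mean of all iterates is at most the mean gap. -/
theorem gap_mean_le {f : Vec p n → ℝ} (hf : ConvexOn ℝ Q f) {Ω : Type*} {K N : ℕ} (hK : 0 < K)
    (hN : 0 < N) {x : Fin K → ℕ → Ω → Vec p n} {ω : Ω} (hx : ∀ i, ∀ k < N, x i k ω ∈ Q) :
    f ((K : ℝ)⁻¹ • ∑ i, trajectoryMean N (x i) ω) - f xs ≤
      (K * N : ℝ)⁻¹ * ∑ i, ∑ k : Fin N, (f (x i k ω) - f xs) := by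
  have hK' : (K : ℝ) ≠ 0 := by exact_mod_cast hK.ne'
  have hN' : (N : ℝ) ≠ 0 := by exact_mod_cast hN.ne'
  have h := hf.map_sum_le (t := (Finset.univ : Finset (Fin K × Fin N)))
    (w := fun _ => (K * N : ℝ)⁻¹) (p := fun a => x a.1 a.2 ω) (fun _ _ => by positivity)
    (by simp; field_simp) (fun a _ => hx a.1 a.2 a.2.2)
  have e1 : (K : ℝ)⁻¹ • ∑ i, trajectoryMean N (x i) ω =
      ∑ a : Fin K × Fin N, (K * N : ℝ)⁻¹ • x a.1 a.2 ω := by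
    simp only [trajectoryMean, Finset.sum_range, Fintype.sum_prod_type, Finset.smul_sum, smul_smul,
      mul_inv]
  rw [e1]
  refine (sub_le_sub_right h _).trans (le_of_eq ?_)
  simp only [Fintype.sum_prod_type, smul_eq_mul, ← Finset.mul_sum, Finset.sum_sub_distrib,
    Finset.sum_const, Finset.card_univ, Fintype.card_fin, nsmul_eq_mul]
  field_simp

end

section

variable {p q : ℝ≥0∞} {n : ℕ} [Fact (1 ≤ p)] [Fact (1 ≤ q)]
  {Q : Set (Vec p n)} {d : Vec p n → ℝ} {x₀ xs : Vec p n}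
  {Ξ : Type*} [MeasurableSpace Ξ] {ν : Measure Ξ} [IsProbabilityMeasure ν]
  {G : Vec p n → Ξ → Vec q n}

/-- The normalized contribution of one stochastic subgradient to the optimality gap: `M` scales the
subgradients, `D` the distances and `T` is the square root of the number of steps. -/
noncomputable def stepLoss (G : Vec p n → Ξ → Vec q n) (ν : Measure Ξ) (xs : Vec p n) (M D T : ℝ)
    (x : Vec p n) (s : Ξ) : ℝ :=
  (‖G x s‖ / M) ^ 2 / T ^ 2 +
    (pairing (∫ r, G x r ∂ν) (x - xs) / (M * D) - pairing (G x s) (x - xs) / (M * D)) / T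

theorem measurable_stepLoss (hG : Measurable (Function.uncurry G)) (M D T : ℝ) :
    Measurable (Function.uncurry (stepLoss G ν xs M D T)) := by
  have h1 : Measurable fun x => ∫ r, G x r ∂ν :=
    (StronglyMeasurable.integral_prod_right hG.stronglyMeasurable).measurable
  have h2 : Measurable fun z : Vec p n × Ξ => G z.1 z.2 := hG
  have h3 : Measurable fun z : Vec p n × Ξ => z.1 - xs := measurable_fst.sub_const xs
  exact (((h2.norm.div_const M).pow_const 2).div_const _).add
    ((((measurable_pairing (h1.comp measurable_fst) h3).div_const _).sub
      ((measurable_pairing h2 h3).div_const _)).div_const _)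

omit [Fact (1 ≤ p)] [IsProbabilityMeasure ν] in
/-- The step loss in terms of the centred projection of the stochastic subgradient. -/
theorem stepLoss_eq {x : Vec p n} (hG : Integrable (G x) ν) (M D T : ℝ) (s : Ξ) :
    stepLoss G ν xs M D T x s = (‖G x s‖ / M) ^ 2 / T ^ 2 +
      (∫ r, pairing (G x r) (x - xs) / (M * D) ∂ν - pairing (G x s) (x - xs) / (M * D)) / T := by
  rw [stepLoss, integral_div, integral_pairing hG]

theorem abs_pairing_div_le [ENNReal.HolderConjugate p q] {x : Vec p n} {M D : ℝ} (hM : 0 < M)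
    (hD : 0 < D) (hx : ‖x - xs‖ ≤ D) (g : Vec q n) :
    |pairing g (x - xs) / (M * D)| ≤ ‖g‖ / M := by
  rw [abs_div, abs_of_pos (mul_pos hM hD), div_le_div_iff₀ (by positivity) hM]
  have := (abs_pairing_le g (x - xs)).trans (mul_le_mul_of_nonneg_left hx (norm_nonneg g))
  nlinarith

/-- The confidence bound for the average of independent runs, given a bound for the exponential
moment of one step outside an exceptional set `S`. -/
theorem one_sub_le_measureReal_gap [ENNReal.HolderConjugate p q] {f : Vec p n → ℝ}
    (hf : ConvexOn ℝ Q f) (hGm : Measurable (Function.uncurry G)) (hG : IsUnbiasedSubgradient Q f G ν) {M : ℝ}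
    (hM : 0 < M) (hprox : IsProxFunction Q d x₀) (hxs : xs ∈ Q)
    {ε R D : ℝ} {N : ℕ} (hε : 0 < ε) (hR : R = √(bregman Q d xs x₀))
    (hD : D = max R (Metric.diam Q)) (hN : 0 < N) {c₀ : ℝ}
    (hCN : c₀ ^ 2 * M ^ 2 * D ^ 2 / ε ^ 2 ≤ N)
    {Ω : Type*} [MeasurableSpace Ω] {μ : Measure Ω} [IsProbabilityMeasure μ] {K : ℕ} (hK : 0 < K)
    {ξ : Fin K → Fin N → Ω → Ξ} {x : Fin K → ℕ → Ω → Vec p n}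
    (hξ : ∀ i k, Measurable (ξ i k)) (hlaw : ∀ i k, μ.map (ξ i k) = ν)
    (hind : iIndepFun (fun ik : Fin K × Fin N => ξ ik.1 ik.2) μ)
    (htraj : ∀ i, IsTrajectory Q d x₀ G (R / M * √(2 / N)) N (ξ i) (x i))
    {s₀ B δ : ℝ} (hs₀ : 0 < s₀) (hδ0 : 0 ≤ δ) {S : Set (Vec p n × Ξ)} (hS : MeasurableSet S)
    (hmoment : 0 < D → ∀ y ∈ Q, ∫⁻ s in {s | (y, s) ∉ S},
      ENNReal.ofReal (Real.exp (s₀ * stepLoss G ν xs M D √N y s)) ∂ν ≤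
        ENNReal.ofReal (Real.exp (B / √N ^ 2)))
    (hδ : ∀ y ∈ Q, ν {s | (y, s) ∈ S} ≤ ENNReal.ofReal δ) :
    1 - (K * N * δ + Real.exp (K * B - s₀ * (c₀ - 1) * K)) ≤
      μ.real {ω | f ((K : ℝ)⁻¹ • ∑ i, trajectoryMean N (x i) ω) - f xs ≤ ε} := by
  have hd := hprox.strongConvex
  have hxQ : ∀ i, ∀ k ≤ N, ∀ ω, x i k ω ∈ Q := fun i k hk ω => (htraj i).mem hprox.mem hk ω
  have hKN : (0 : ℝ) < K * N := by positivity
  have hgap := fun ω => gap_mean_le (xs := xs) hf hK hN (x := x) (ω := ω)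
    fun i k hk => hxQ i k hk.le ω
  rcases (hR ▸ Real.sqrt_nonneg _ : 0 ≤ R).eq_or_lt with hR0 | hR0
  · -- the starting point is the solution and no run leaves it
    have hb := half_sq_le_bregman hd hprox.mem hxs hprox.diff
    have hb0 : bregman Q d xs x₀ ≤ 0 := Real.sqrt_eq_zero'.1 (hR ▸ hR0.symm)
    have hx0 : xs = x₀ := by
      have : ‖xs - x₀‖ = 0 := by nlinarith [norm_nonneg (xs - x₀)]
      exact sub_eq_zero.1 (norm_eq_zero.1 this)
    have hall : {ω | f ((K : ℝ)⁻¹ • ∑ i, trajectoryMean N (x i) ω) - f xs ≤ ε} = Set.univ := by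
      refine Set.eq_univ_of_forall fun ω => (hgap ω).trans ?_
      have : ∀ i, ∀ k : Fin N, x i k ω = xs := fun i k => by
        rw [hx0]
        exact (htraj i).eq_start hd hprox.mem (by rw [← hR0]; simp) k.2.le ω
      simp [this, hε.le]
    rw [hall, probReal_univ]
    have : 0 ≤ K * N * δ := by positivity
    linarith [Real.exp_pos (K * B - s₀ * (c₀ - 1) * K)]
  have hRD : R ≤ D := hD ▸ le_max_left _ _
  have hD0 : 0 < D := hR0.trans_le hRD
  have hT0 : 0 < √(N : ℝ) := Real.sqrt_pos.2 (by exact_mod_cast hN)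
  have hT2 : √(N : ℝ) ^ 2 = N := Real.sq_sqrt (Nat.cast_nonneg N)
  -- order the samples lexicographically
  set ξ' : Fin K ×ₗ Fin N → Ω → Ξ := fun a => ξ (ofLex a).1 (ofLex a).2 with hξ'
  set X : Fin K ×ₗ Fin N → Ω → Vec p n := fun a => x (ofLex a).1 (ofLex a).2 with hX
  have hXm : ∀ a, Measurable[past ξ' a] (X a) := by
    intro a
    refine ((htraj (ofLex a).1).adapted _ (ofLex a).2.2.le).mono
      (iSup₂_le fun j hj => ?_) le_rfl
    refine le_iSup₂_of_le (toLex ((ofLex a).1, j)) ?_ le_rfl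
    exact Prod.Lex.lt_iff.2 (Or.inr ⟨rfl, hj⟩)
  have hind' : iIndepFun ξ' μ := hind.precomp (g := ofLex) ofLex.injective
  obtain ⟨bad, hbadm, hbadμ, hbad⟩ := measure_sum_gt_le (ν := ν) (ξ := ξ') (X := X)
    (W := fun y s => s₀ * stepLoss G ν xs M D √N y s) (b := B / √N ^ 2) (δ := δ)
    (θ := s₀ * (c₀ - 1) * K) (fun a => hξ _ _) (fun a => hlaw _ _) hind' hXm
    ((measurable_stepLoss hGm M D √N).const_mul s₀) hS hδ0
    (fun a ω => hmoment hD0 _ (hxQ _ _ (ofLex a).2.2.le ω))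
    (fun a ω => hδ _ (hxQ _ _ (ofLex a).2.2.le ω))
  have hcard : (Fintype.card (Fin K ×ₗ Fin N) : ℝ) = K * N := by
    rw [Fintype.card_lex]; simp
  rw [hcard, hT2] at hbadμ
  have hKB : (K : ℝ) * N * (B / N) = K * B := by field_simp
  rw [hKB] at hbadμ
  have hsub : badᶜ ⊆ {ω | f ((K : ℝ)⁻¹ • ∑ i, trajectoryMean N (x i) ω) - f xs ≤ ε} := by
    intro ω hω
    refine (hgap ω).trans ?_
    have h1 : ∀ i, ∑ k : Fin N, (f (x i k ω) - f xs) ≤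
        M * D * √N * (1 + ∑ k : Fin N, stepLoss G ν xs M D √N (x i k ω) (ξ i k ω)) := by
      intro i
      refine sum_gap_le hd hN hxs (x := fun k => x i k ω) (fun k hk => hxQ i k hk ω)
        (fun k hk => (htraj i).diff k hk ω) (by rw [(htraj i).start]; exact hR) hR0 hRD hM
        (fun k => (htraj i).step k ω) fun k => ?_
      have := (hG _ (hxQ i k k.2.le ω)).2 xs hxs
      rw [← neg_sub, pairing_neg_right] at this
      linarith
    have h2 : ∑ i, ∑ k : Fin N, stepLoss G ν xs M D √N (x i k ω) (ξ i k ω) < (c₀ - 1) * K := by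
      have h3 := hbad ω hω
      rw [← Finset.mul_sum, mul_assoc] at h3
      have h4 := lt_of_mul_lt_mul_left h3 hs₀.le
      have h5 : ∑ a : Fin K ×ₗ Fin N, stepLoss G ν xs M D √N (X a ω) (ξ' a ω) =
          ∑ a : Fin K × Fin N, stepLoss G ν xs M D √N (x a.1 a.2 ω) (ξ a.1 a.2 ω) :=
        Equiv.sum_comp ofLex
          fun a : Fin K × Fin N => stepLoss G ν xs M D √N (x a.1 a.2 ω) (ξ a.1 a.2 ω)
      rwa [h5, Fintype.sum_prod_type] at h4
    have h6 : c₀ * (M * D) ≤ ε * √N := by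
      refine le_of_sq_le_sq ?_ (by positivity)
      rw [div_le_iff₀ (by positivity)] at hCN
      rw [mul_pow ε, hT2]
      nlinarith
    rw [inv_mul_le_iff₀ hKN]
    calc ∑ i, ∑ k : Fin N, (f (x i k ω) - f xs)
        ≤ ∑ i, M * D * √N * (1 + ∑ k : Fin N, stepLoss G ν xs M D √N (x i k ω) (ξ i k ω)) :=
          Finset.sum_le_sum fun i _ => h1 i
      _ = M * D * √N * (K + ∑ i, ∑ k : Fin N, stepLoss G ν xs M D √N (x i k ω) (ξ i k ω)) := by
          rw [← Finset.mul_sum, Finset.sum_add_distrib]; simp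
      _ ≤ M * D * √N * (c₀ * K) := by gcongr; linarith
      _ = c₀ * (M * D) * √N * K := by ring
      _ ≤ ε * √N * √N * K := by gcongr
      _ = K * N * ε := by rw [mul_assoc ε, ← pow_two, hT2]; ring
  calc 1 - (K * N * δ + Real.exp (K * B - s₀ * (c₀ - 1) * K)) ≤ 1 - μ.real bad := by linarith
    _ = μ.real badᶜ := (probReal_compl_eq_one_sub hbadm).symm
    _ ≤ _ := measureReal_mono hsub

end

theorem neg_log_le_numTrajectories {σ : ℝ} :
    -Real.log σ ≤ numTrajectories σ * (Real.log 2 / 2) := by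
  have h : 2 * Real.logb 2 σ⁻¹ ≤ numTrajectories σ := Nat.le_ceil _
  have h2 : 0 < Real.log 2 := Real.log_pos one_lt_two
  rw [Real.logb, Real.log_inv, mul_div_assoc', div_le_iff₀ h2] at h
  linarith

theorem numTrajectories_sub_one_lt {σ : ℝ} (hσ0 : 0 < σ) (hσ1 : σ < 1) :
    (numTrajectories σ - 1) * (Real.log 2 / 2) < -Real.log σ := by
  have h2 : 0 < Real.log 2 := Real.log_pos one_lt_two
  have hl := Real.log_neg hσ0 hσ1
  have h : (numTrajectories σ : ℝ) < 2 * Real.logb 2 σ⁻¹ + 1 := Nat.ceil_lt_add_one (by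
    rw [Real.logb, Real.log_inv]
    exact mul_nonneg zero_le_two (div_nonneg (by linarith) h2.le))
  rw [← sub_lt_iff_lt_add, Real.logb, Real.log_inv, mul_div_assoc', lt_div_iff₀ h2] at h
  linarith

theorem numTrajectories_pos {σ : ℝ} (hσ0 : 0 < σ) (hσ1 : σ < 1) : 0 < numTrajectories σ := by
  refine Nat.pos_of_ne_zero fun h => ?_
  have := neg_log_le_numTrajectories (σ := σ)
  rw [h, Nat.cast_zero, zero_mul] at this
  linarith [Real.log_neg hσ0 hσ1]

theorem exp_neg_numTrajectories_le {σ : ℝ} (hσ0 : 0 < σ) :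
    Real.exp (-numTrajectories σ) ≤ σ := by
  rw [← Real.le_log_iff_exp_le hσ0]
  have h := neg_log_le_numTrajectories (σ := σ)
  have h2 : Real.log 2 / 2 ≤ 1 := by linarith [Real.log_two_lt_d9]
  nlinarith [Nat.cast_nonneg (α := ℝ) (numTrajectories σ)]

theorem exp_mul_numTrajectories_mul_le {σ : ℝ} (hσ0 : 0 < σ) (hσ1 : σ < 1) :
    Real.exp (3 / 10 * numTrajectories σ) * (σ / 2) ≤ 1 := by
  have h := numTrajectories_sub_one_lt hσ0 hσ1
  have hK : (1 : ℝ) ≤ numTrajectories σ := by exact_mod_cast numTrajectories_pos hσ0 hσ1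
  rw [← Real.exp_log (half_pos hσ0), ← Real.exp_add, Real.exp_le_one_iff,
    Real.log_div hσ0.ne' two_ne_zero]
  nlinarith [Real.log_two_gt_d9]

theorem rpow_one_sub_le_half {α σ N : ℝ} (hα : 2 < α) (hσ0 : 0 < σ)
    (hN : 2 * σ ^ (-1 / (α - 1)) ≤ N) : N ^ (1 - α) ≤ σ / 2 := by
  have hs : 0 < σ ^ (-1 / (α - 1)) := Real.rpow_pos_of_pos hσ0 _
  calc N ^ (1 - α) ≤ (2 * σ ^ (-1 / (α - 1))) ^ (1 - α) :=
        Real.rpow_le_rpow_of_nonpos (by positivity) hN (by linarith)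
    _ = 2 ^ (1 - α) * σ := by
        have h1 : -1 / (α - 1) * (1 - α) = 1 := by
          have : α - 1 ≠ 0 := by linarith
          field_simp
          ring
        rw [Real.mul_rpow zero_le_two hs.le, ← Real.rpow_mul hσ0.le, h1, Real.rpow_one]
    _ ≤ 2 ^ (-1 : ℝ) * σ := by
        gcongr
        · exact one_le_two
        · linarith
    _ = σ / 2 := by rw [Real.rpow_neg_one]; ring

section

variable {p q : ℝ≥0∞} {n : ℕ} [Fact (1 ≤ q)]
  {Q : Set (Vec p n)} {Ξ : Type*} [MeasurableSpace Ξ] {ν : Measure Ξ} [IsProbabilityMeasure ν]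
  {G : Vec p n → Ξ → Vec q n} {M : ℝ}

theorem TailRegime.Holds.subGaussian_of_bounded (hM : 0 < M)
    (h : TailRegime.bounded.Holds Q G ν M) : TailRegime.subGaussian.Holds Q G ν M := by
  intro x hx
  refine (lintegral_mono_ae (g := fun _ => ENNReal.ofReal (Real.exp 1)) ?_).trans (by simp)
  filter_upwards [h x hx] with s hs
  refine ENNReal.ofReal_le_ofReal (Real.exp_le_exp.2 ?_)
  rw [div_le_one (by positivity)]
  gcongr

variable [Fact (1 ≤ p)] [ENNReal.HolderConjugate p q]
  {d : Vec p n → ℝ} {x₀ xs : Vec p n} {f : Vec p n → ℝ}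

theorem norm_sub_le_max_diam (hbdd : Bornology.IsBounded Q) {x y : Vec p n} (hx : x ∈ Q)
    (hy : y ∈ Q) (R : ℝ) : ‖x - y‖ ≤ max R (Metric.diam Q) := by
  rw [← dist_eq_norm]
  exact (Metric.dist_le_diam_of_mem hbdd hx hy).trans (le_max_right _ _)

theorem one_sub_le_measureReal_gap_of_subGaussian
    (hbdd : Bornology.IsBounded Q) (hf : ConvexOn ℝ Q f)
    (hGm : Measurable (Function.uncurry G)) (hG : IsUnbiasedSubgradient Q f G ν)
    (hM : 0 < M) (htail : TailRegime.subGaussian.Holds Q G ν M)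
    (hprox : IsProxFunction Q d x₀) (hxs : xs ∈ Q)
    {ε σ R : ℝ} {N : ℕ} (hε : 0 < ε) (hσ0 : 0 < σ) (hσ1 : σ < 1)
    (hR : R = √(bregman Q d xs x₀)) (hN : 0 < N)
    (hCN : 150 * M ^ 2 * max R (Metric.diam Q) ^ 2 / ε ^ 2 ≤ N)
    {Ω : Type*} [MeasurableSpace Ω] {μ : Measure Ω} [IsProbabilityMeasure μ]
    {ξ : Fin (numTrajectories σ) → Fin N → Ω → Ξ} {x : Fin (numTrajectories σ) → ℕ → Ω → Vec p n}
    (hξ : ∀ i k, Measurable (ξ i k)) (hlaw : ∀ i k, μ.map (ξ i k) = ν)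
    (hind : iIndepFun (fun ik : Fin (numTrajectories σ) × Fin N => ξ ik.1 ik.2) μ)
    (htraj : ∀ i, IsTrajectory Q d x₀ G (R / M * √(2 / N)) N (ξ i) (x i)) :
    1 - σ ≤ μ.real {ω | f ((numTrajectories σ : ℝ)⁻¹ • ∑ i, trajectoryMean N (x i) ω) - f xs
      ≤ ε} := by
  have hK := numTrajectories_pos hσ0 hσ1
  have hT : 1 ≤ √(N : ℝ) := Real.one_le_sqrt.2 (by exact_mod_cast hN)
  have h := one_sub_le_measureReal_gap (c₀ := √150) (s₀ := 1 / 4) (B := 1) (δ := 0) (S := ∅) hf hGm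
    hG hM hprox hxs hε hR rfl hN (by rwa [Real.sq_sqrt (by norm_num)]) hK hξ hlaw hind htraj
    (by norm_num) le_rfl MeasurableSet.empty (fun hD y hy => ?_) (fun y _ => by simp)
  · refine le_trans ?_ h
    have h12 : (12 : ℝ) ≤ √150 := Real.le_sqrt_of_sq_le (by norm_num)
    have hK' : (1 : ℝ) ≤ numTrajectories σ := by exact_mod_cast hK
    have h1 : Real.exp (numTrajectories σ * 1 - 1 / 4 * (√150 - 1) * numTrajectories σ) ≤
        Real.exp (-numTrajectories σ) := Real.exp_le_exp.2 (by nlinarith)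
    linarith [exp_neg_numTrajectories_le hσ0]
  · refine (setLIntegral_le_lintegral _ _).trans ?_
    simp_rw [stepLoss_eq (hG y hy).1]
    refine lintegral_exp_le_of_subGaussian (U := fun s => ‖G y s‖ / M)
      (Y := fun s => pairing (G y s) (y - xs) / (M * max R (Metric.diam Q)))
      (((hGm.comp measurable_prodMk_left).norm).div_const M) ?_
      ((integrable_pairing (hG y hy).1 _).div_const _)
      (fun s => abs_pairing_div_le hM hD (norm_sub_le_max_diam hbdd hy hxs R) _) hT
    simp_rw [div_pow]
    exact htail y hy

theorem one_sub_le_measureReal_gap_of_heavy {α : ℝ} (hα : 2 < α)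
    (hbdd : Bornology.IsBounded Q) (hf : ConvexOn ℝ Q f)
    (hGm : Measurable (Function.uncurry G)) (hG : IsUnbiasedSubgradient Q f G ν)
    (hM : 0 < M) (htail : (TailRegime.heavy α).Holds Q G ν M)
    (hprox : IsProxFunction Q d x₀) (hxs : xs ∈ Q)
    {ε σ R : ℝ} {N : ℕ} (hε : 0 < ε) (hσ0 : 0 < σ) (hσ1 : σ < 1)
    (hR : R = √(bregman Q d xs x₀)) (hN : 0 < N)
    (hCN : 41 ^ 2 * M ^ 2 * max R (Metric.diam Q) ^ 2 / ε ^ 2 ≤ N)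
    (hlong : 2 * σ ^ (-1 / (α - 1)) ≤ N)
    {Ω : Type*} [MeasurableSpace Ω] {μ : Measure Ω} [IsProbabilityMeasure μ]
    {ξ : Fin (numTrajectories σ) → Fin N → Ω → Ξ} {x : Fin (numTrajectories σ) → ℕ → Ω → Vec p n}
    (hξ : ∀ i k, Measurable (ξ i k)) (hlaw : ∀ i k, μ.map (ξ i k) = ν)
    (hind : iIndepFun (fun ik : Fin (numTrajectories σ) × Fin N => ξ ik.1 ik.2) μ)
    (htraj : ∀ i, IsTrajectory Q d x₀ G (R / M * √(2 / N)) N (ξ i) (x i)) :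
    1 - σ ≤ μ.real {ω | f ((numTrajectories σ : ℝ)⁻¹ • ∑ i, trajectoryMean N (x i) ω) - f xs
      ≤ ε} := by
  have hK := numTrajectories_pos hσ0 hσ1
  have hσK := exp_neg_numTrajectories_le hσ0
  have hσK2 := exp_mul_numTrajectories_mul_le hσ0 hσ1
  have hK' : (1 : ℝ) ≤ numTrajectories σ := by exact_mod_cast hK
  generalize numTrajectories σ = K at *
  have hN' : (1 : ℝ) ≤ N := by exact_mod_cast hN
  have hT : 1 ≤ √(N : ℝ) := Real.one_le_sqrt.2 hN'
  have hT2 : √(N : ℝ) ^ 2 = N := Real.sq_sqrt (Nat.cast_nonneg N)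
  have hhalf := rpow_one_sub_le_half hα hσ0 hlong
  have hrpow : ∀ t : ℝ, 1 ≤ t → t * (1 + t) ^ (-α) ≤ t ^ (1 - α) := fun t ht => by
    rw [sub_eq_add_neg, Real.rpow_add (by linarith), Real.rpow_one]
    exact mul_le_mul_of_nonneg_left
      (Real.rpow_le_rpow_of_nonpos (by linarith) (by linarith) (by linarith)) (by linarith)
  have htail' : ∀ y ∈ Q, ∀ t : ℝ, 0 ≤ t → ν.real {s | t ≤ (‖G y s‖ / M) ^ 2} ≤ (1 + t) ^ (-α) := by
    simp_rw [div_pow]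
    exact htail
  have hU : ∀ y, Measurable fun s => ‖G y s‖ / M := fun y =>
    ((hGm.comp measurable_prodMk_left).norm).div_const M
  have h := one_sub_le_measureReal_gap (c₀ := 41) (s₀ := 1 / 10) (B := 2)
    (δ := (1 + K * √(N : ℝ) ^ 2) ^ (-α))
    (S := {z | K * √(N : ℝ) ^ 2 < (‖G z.1 z.2‖ / M) ^ 2}) hf hGm
    hG hM hprox hxs hε hR rfl hN hCN hK hξ hlaw hind htraj
    (by norm_num) (by positivity)
    (measurableSet_lt measurable_const ((hGm.norm.div_const M).pow_const 2))
    (fun hD y hy => ?_) (fun y hy => ?_)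
  · refine le_trans ?_ h
    have h1 : Real.exp (K * 2 - 1 / 10 * (41 - 1) * K) ≤ σ / 2 := by
      have e : Real.exp (K * 2 - 1 / 10 * (41 - 1) * K) = Real.exp (-K) * Real.exp (-K) := by
        rw [← Real.exp_add]; congr 1; ring
      have e2 : Real.exp (-(K : ℝ)) ≤ 1 / 2 := by
        rw [Real.exp_neg, one_div]
        refine inv_anti₀ two_pos ?_
        linarith [Real.add_one_le_exp (K : ℝ)]
      rw [e]
      nlinarith [Real.exp_pos (-(K : ℝ))]
    have h2 : K * N * (1 + K * √(N : ℝ) ^ 2) ^ (-α) ≤ σ / 2 := by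
      rw [hT2]
      refine (hrpow (K * N) (one_le_mul_of_one_le_of_one_le hK' hN')).trans (le_trans ?_ hhalf)
      exact Real.rpow_le_rpow_of_nonpos (by linarith)
        (le_mul_of_one_le_left (by linarith) hK') (by linarith)
    linarith
  · simp_rw [stepLoss_eq (hG y hy).1]
    refine setLIntegral_exp_le_of_tail (U := fun s => ‖G y s‖ / M)
      (Y := fun s => pairing (G y s) (y - xs) / (M * max R (Metric.diam Q)))
      (hU y) hα (htail' y hy) ((integrable_pairing (hG y hy).1 _).div_const _)
      (fun s => abs_pairing_div_le hM hD (norm_sub_le_max_diam hbdd hy hxs R) _) hT hK' ?_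
    rw [hT2, le_div_iff₀ (by linarith), mul_assoc, mul_comm _ (N : ℝ)]
    refine le_trans ?_ hσK2
    gcongr
    exact (hrpow N hN').trans hhalf
  · rw [← ofReal_measureReal]
    refine ENNReal.ofReal_le_ofReal (le_trans ?_ (htail' y hy _ (by positivity)))
    refine measureReal_mono fun s hs => ?_
    simp only [Set.mem_ofPred_eq] at hs ⊢
    exact hs.le

end

end MirrorDescent
theorem mainTheorem2 (r : MirrorDescent.TailRegime) (hr : r.Admissible) :
    ∃ C : ℝ, 0 < C ∧ r.ConstantRange C ∧ ∃ c : ℝ, 0 < c ∧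
      ∀ (n : ℕ) (p q : ℝ≥0∞) [Fact (1 ≤ p)] [Fact (1 ≤ q)] [ENNReal.HolderConjugate p q],
      p ≤ 2 →
      -- the problem: minimize `f(x) = E_ξ F(x, ξ)` over the bounded convex set `Q`
      ∀ (Ξ : Type u) [MeasurableSpace Ξ] (ν : Measure Ξ) [IsProbabilityMeasure ν]
        (Q : Set (MirrorDescent.Vec p n)) (F : MirrorDescent.Vec p n → Ξ → ℝ)
        (G : MirrorDescent.Vec p n → Ξ → MirrorDescent.Vec q n) (M : ℝ),
      Convex ℝ Q → Bornology.IsBounded Q →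
      (∀ x ∈ Q, Integrable (F x) ν) →
      ConvexOn ℝ Q (MirrorDescent.objective F ν) →
      Measurable (Function.uncurry G) →
      MirrorDescent.IsUnbiasedSubgradient Q (MirrorDescent.objective F ν) G ν →
      0 < M → r.Holds Q G ν M →
      -- the prox-function, the starting point and a solution
      ∀ (d : MirrorDescent.Vec p n → ℝ) (x₀ xs : MirrorDescent.Vec p n),
      MirrorDescent.IsProxFunction Q d x₀ →
      xs ∈ Q → IsMinOn (MirrorDescent.objective F ν) Q xs →
      -- accuracy, confidence level, `R`, `R̄`, and the number of steps
      ∀ (ε σ R Rbar : ℝ) (N : ℕ), 0 < ε → 0 < σ → σ < 1 →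
      R = √(MirrorDescent.bregman Q d xs x₀) → Rbar = Metric.diam Q →
      0 < N → C * M ^ 2 * max R Rbar ^ 2 / ε ^ 2 ≤ N → r.LongEnough c σ N →
      -- `K` independent mirror-descent trajectories
      ∀ (Ω : Type v) [MeasurableSpace Ω] (μ : Measure Ω) [IsProbabilityMeasure μ]
        (ξ : Fin (MirrorDescent.numTrajectories σ) → Fin N → Ω → Ξ)
        (x : Fin (MirrorDescent.numTrajectories σ) → ℕ → Ω → MirrorDescent.Vec p n),
      (∀ i k, Measurable (ξ i k)) → (∀ i k, μ.map (ξ i k) = ν) →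
      iIndepFun (fun ik : Fin (MirrorDescent.numTrajectories σ) × Fin N => ξ ik.1 ik.2) μ →
      (∀ i, MirrorDescent.IsTrajectory Q d x₀ G (R / M * √(2 / N)) N (ξ i) (x i)) →
      1 - σ ≤ μ.real {ω | MirrorDescent.objective F ν
            ((MirrorDescent.numTrajectories σ : ℝ)⁻¹ •
              ∑ i, MirrorDescent.trajectoryMean N (x i) ω)
          - MirrorDescent.objective F ν xs ≤ ε} := by
  cases r with
  | bounded =>
    refine ⟨150, by norm_num, by norm_num [MirrorDescent.TailRegime.ConstantRange], 1, one_pos, ?_⟩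
    intro n p q _ _ _ _ Ξ _ ν _ Q F G M _ hbdd _ hf hGm hG hM htail d x₀ xs hprox hxs _ ε σ R Rbar N
      hε hσ0 hσ1 hR hRbar hN hCN _ Ω _ μ _ ξ x hξ hlaw hind htraj
    subst hRbar
    exact MirrorDescent.one_sub_le_measureReal_gap_of_subGaussian hbdd hf hGm hG hM
      (htail.subGaussian_of_bounded hM) hprox hxs hε hσ0 hσ1 hR hN hCN hξ hlaw hind htraj
  | subGaussian =>
    refine ⟨150, by norm_num, by norm_num [MirrorDescent.TailRegime.ConstantRange], 1, one_pos, ?_⟩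
    intro n p q _ _ _ _ Ξ _ ν _ Q F G M _ hbdd _ hf hGm hG hM htail d x₀ xs hprox hxs _ ε σ R Rbar N
      hε hσ0 hσ1 hR hRbar hN hCN _ Ω _ μ _ ξ x hξ hlaw hind htraj
    subst hRbar
    exact MirrorDescent.one_sub_le_measureReal_gap_of_subGaussian hbdd hf hGm hG hM
      htail hprox hxs hε hσ0 hσ1 hR hN hCN hξ hlaw hind htraj
  | heavy α =>
    refine ⟨41 ^ 2, by norm_num, trivial, 2, two_pos, ?_⟩
    intro n p q _ _ _ _ Ξ _ ν _ Q F G M _ hbdd _ hf hGm hG hM htail d x₀ xs hprox hxs _ ε σ R Rbar N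
      hε hσ0 hσ1 hR hRbar hN hCN hlong Ω _ μ _ ξ x hξ hlaw hind htraj
    subst hRbar
    exact MirrorDescent.one_sub_le_measureReal_gap_of_heavy hr hbdd hf hGm hG hM
      htail hprox hxs hε hσ0 hσ1 hR hN hCN hlong hξ hlaw hind htraj
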